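/- **Proposition 4.1.** Let $\mathbb K\in\{\mathbb R,\mathbb C\}$; manifolds are finite-dimensional, without boundary, and smooth (holomorphic if $\mathbb K=\mathbb C$). Let $(G,\pi_G)$ be a connected Poisson Lie group, i.e. a connected Lie group with a Poisson bivector field $\pi_G$ such that multiplication $G\times G\to G$ is a Poisson map for the product Poisson structure, and let $\mathfrak g=T_eG$. Put $\pi^r(g)=(r_{g^{-1}})_*\pi_G(g)\in\bigwedge^2\mathfrak g$, where $r_h$ is right translation by $h$, let $\delta=d_e\pi^r:\mathfrak g\to\bigwedge^2\mathfrak g$, and equip $\mathfrak g^*$ with the dual bracket $\langle[\xi,\eta]_*,X\rangle=\langle\delta(X),\xi\wedge\eta\rangle$. Let $(P,\pi_P)$ be a Poisson manifold and let $\sigma:G\times P\to P$, $\sigma(g,p)=gp$, be a Poisson action, i.e. a smooth left action that is a Poisson map for the product structure $\pi_G\oplus\pi_P$. For $p\in P$ let $\lambda_p:\mathfrak g\to T_pP$ be the differential at $e$ of $g\mapsto gp$, let $\mathfrak g_p=\ker\lambda_p$ be the isotropy subalgebra at $p$, and let $\mathfrak g_p^\circ=\{\xi\in\mathfrak g^*:\xi|_{\mathfrak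 g_p}=0\}$ be its annihilator. Then: 1. The action preserves the Poisson structure of $P$ (that is, for every $g\in G$ the map $\sigma_g:P\to P$, $p\mapsto gp$, is a Poisson map) if and only if for every $p\in P$ the annihilator $\mathfrak g_p^\circ$ is an abelian subalgebra of $(\mathfrak g^*,[\cdot,\cdot]_*)$, i.e. $[\xi,\eta]_*=0$ for all $\xi,\eta\in\mathfrak g_p^\circ$. 2. In particular, if $P\neq\emptyset$ and the action is locally free (that is, $\mathfrak g_p=0$ for every $p\in P$), then the action preserves the Poisson structure of $P$ if and only if $\pi_G=0$. -/

import Mathlib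

open scoped Manifold ContDiff

noncomputable section

section Poisson

variable {𝕜 : Type*} [RCLike 𝕜]
  {E : Type*} [NormedAddCommGroup E] [NormedSpace 𝕜 E]
  {H : Type*} [TopologicalSpace H]
  {E' : Type*} [NormedAddCommGroup E'] [NormedSpace 𝕜 E']
  {H' : Type*} [TopologicalSpace H']

/-- A field of bilinear forms on the cotangent spaces of `M`. In finite dimension, an element of
`⋀² T_p M` is the same as an alternating bilinear form on `T_p^* M`; the alternating and smooth
ones among these fields are the bivector fields (see `IsPoisson`). -/
abbrev CotangentForm (I : ModelWithCorners 𝕜 E H)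
    (M : Type*) [TopologicalSpace M] [ChartedSpace H M] : Type _ :=
  ∀ p : M, LinearMap.BilinForm 𝕜 (Module.Dual 𝕜 (TangentSpace I p))

/-- The differential `df(p)` of a scalar function, as an element of `T_p^* M`. -/
def differential (I : ModelWithCorners 𝕜 E H) {M : Type*} [TopologicalSpace M] [ChartedSpace H M]
    (f : M → 𝕜) (p : M) : Module.Dual 𝕜 (TangentSpace I p) :=
  (mvfderiv I f p).toLinearMap

/-- The bracket `{f, g} = π(df, dg)`. -/
def poissonBracket {I : ModelWithCorners 𝕜 E H} {M : Type*} [TopologicalSpace M]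
    [ChartedSpace H M] (π : CotangentForm I M) (f g : M → 𝕜) (p : M) : 𝕜 :=
  π p (differential I f p) (differential I g p)

/-- `π` is a Poisson structure: it is a smooth bivector field whose bracket satisfies the Jacobi
identity. Both conditions are tested on functions that are smooth (holomorphic if `𝕜 = ℂ`) near a
point, so that the definition also fits complex manifolds, which may have few global
holomorphic functions. -/
structure IsPoisson {I : ModelWithCorners 𝕜 E H} {M : Type*} [TopologicalSpace M]
    [ChartedSpace H M] (π : CotangentForm I M) : Prop where
  alternating : ∀ (p : M) (α : Module.Dual 𝕜 (TangentSpace I p)), π p α α = 0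
  smooth : ∀ (p : M) (f g : M → 𝕜), ContMDiffAt I 𝓘(𝕜, 𝕜) ∞ f p → ContMDiffAt I 𝓘(𝕜, 𝕜) ∞ g p →
    ContMDiffAt I 𝓘(𝕜, 𝕜) ∞ (poissonBracket π f g) p
  jacobi : ∀ (p : M) (f g h : M → 𝕜), ContMDiffAt I 𝓘(𝕜, 𝕜) ∞ f p →
    ContMDiffAt I 𝓘(𝕜, 𝕜) ∞ g p → ContMDiffAt I 𝓘(𝕜, 𝕜) ∞ h p →
    poissonBracket π f (poissonBracket π g h) p + poissonBracket π g (poissonBracket π h f) p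
      + poissonBracket π h (poissonBracket π f g) p = 0

/-- A smooth map whose pull-back of (locally defined) smooth functions preserves brackets. -/
structure IsPoissonMap {I : ModelWithCorners 𝕜 E H} {J : ModelWithCorners 𝕜 E' H'}
    {M : Type*} [TopologicalSpace M] [ChartedSpace H M]
    {N : Type*} [TopologicalSpace N] [ChartedSpace H' N]
    (πM : CotangentForm I M) (πN : CotangentForm J N) (φ : M → N) : Prop where
  smooth : ContMDiff I J ∞ φ
  map_bracket : ∀ (x : M) (f g : N → 𝕜), ContMDiffAt J 𝓘(𝕜, 𝕜) ∞ f (φ x) →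
    ContMDiffAt J 𝓘(𝕜, 𝕜) ∞ g (φ x) →
    poissonBracket πM (f ∘ φ) (g ∘ φ) x = poissonBracket πN f g (φ x)

/-- The product structure `π_M ⊕ π_N`: at `(x, y)` it is the sum of the push-forwards of `π_M(x)`
and `π_N(y)` under the inclusions `M → M × {y}` and `N → {x} × N`. -/
def prodForm {I : ModelWithCorners 𝕜 E H} {J : ModelWithCorners 𝕜 E' H'}
    {M : Type*} [TopologicalSpace M] [ChartedSpace H M]
    {N : Type*} [TopologicalSpace N] [ChartedSpace H' N]
    (πM : CotangentForm I M) (πN : CotangentForm J N) : CotangentForm (I.prod J) (M × N) :=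
  fun z =>
    let ι₁ := (mfderiv I (I.prod J) (fun x : M => (x, z.2)) z.1).toLinearMap.dualMap
    let ι₂ := (mfderiv J (I.prod J) (fun y : N => (z.1, y)) z.2).toLinearMap.dualMap
    (πM z.1).compl₁₂ ι₁ ι₁ + (πN z.2).compl₁₂ ι₂ ι₂

section Group

variable {I : ModelWithCorners 𝕜 E H} {G : Type*} [TopologicalSpace G] [ChartedSpace H G] [Group G]

/-- `(G, π)` is a Poisson Lie group: `π` is Poisson and multiplication is a Poisson map. -/
structure IsPoissonLie (π : CotangentForm I G) : Prop where
  isPoisson : IsPoisson π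
  mul : IsPoissonMap (prodForm π π) π (fun z : G × G => z.1 * z.2)

/-- Differential at `g` of right translation by `g⁻¹`, a map `T_g G → T_e G = 𝔤`. -/
def rightTransport (I : ModelWithCorners 𝕜 E H) (g : G) :
    TangentSpace I g →L[𝕜] GroupLieAlgebra I G :=
  (mfderiv I I (fun h : G => h * g⁻¹) g : TangentSpace I g →L[𝕜] TangentSpace I (g * g⁻¹))

/-- `π^r(g) = r_{g⁻¹} π(g)`, an element of `⋀² 𝔤` viewed as a bilinear form on `𝔤^*`. -/
def rightForm (π : CotangentForm I G) (g : G) :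
    LinearMap.BilinForm 𝕜 (Module.Dual 𝕜 (GroupLieAlgebra I G)) :=
  (π g).compl₁₂ (rightTransport I g).toLinearMap.dualMap (rightTransport I g).toLinearMap.dualMap

/-- The bracket on `𝔤^*` dual to `δ = d_e π^r : 𝔤 → ⋀² 𝔤`:
`⟨[ξ, η]_*, X⟩ = ⟨δ(X), ξ ∧ η⟩`. -/
def dualBracket (π : CotangentForm I G) (ξ η : Module.Dual 𝕜 (GroupLieAlgebra I G)) :
    Module.Dual 𝕜 (GroupLieAlgebra I G) :=
  differential I (fun g : G => rightForm π g ξ η) (1 : G)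

/-- A subspace of `𝔤^*` is an abelian subalgebra for the dual bracket (all brackets of its elements
vanish, so it is in particular closed under the bracket). -/
def IsAbelianSubspace (π : CotangentForm I G)
    (S : Submodule 𝕜 (Module.Dual 𝕜 (GroupLieAlgebra I G))) : Prop :=
  ∀ ξ ∈ S, ∀ η ∈ S, dualBracket π ξ η = 0

variable (I) (J : ModelWithCorners 𝕜 E' H') {P : Type*} [TopologicalSpace P] [ChartedSpace H' P]
  [MulAction G P]

/-- The infinitesimal action at `p`, `X ↦ λ(X)(p) = σ_{p*} X`. -/
def infinitesimalAction (G : Type*) [TopologicalSpace G] [ChartedSpace H G] [Group G]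
    [MulAction G P] (p : P) : GroupLieAlgebra I G →L[𝕜] TangentSpace J ((1 : G) • p) :=
  mfderiv I J (fun g : G => g • p) (1 : G)

/-- The isotropy subalgebra `𝔤_p = {X | λ(X)(p) = 0}`. -/
def isotropyAlgebra (G : Type*) [TopologicalSpace G] [ChartedSpace H G] [Group G]
    [MulAction G P] (p : P) : Submodule 𝕜 (GroupLieAlgebra I G) :=
  LinearMap.ker (infinitesimalAction I J G p).toLinearMap

/-- The action is locally free: every isotropy subalgebra is trivial. -/
def IsLocallyFreeAction (G P : Type*) [TopologicalSpace G] [ChartedSpace H G] [Group G]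
    [TopologicalSpace P] [ChartedSpace H' P] [MulAction G P] : Prop :=
  ∀ p : P, isotropyAlgebra I J G p = ⊥

variable {I J}

/-- The action map `σ : G × P → P` is a Poisson map. -/
def IsPoissonAction (πG : CotangentForm I G) (πP : CotangentForm J P) : Prop :=
  IsPoissonMap (prodForm πG πP) πP (fun z : G × P => z.1 • z.2)

/-- Each `σ_g : P → P` is a Poisson map. -/
def ActionPreserves (G : Type*) [Group G] [MulAction G P] (πP : CotangentForm J P) : Prop :=
  ∀ g : G, IsPoissonMap πP πP (fun x : P => g • x)

end Group

end Poisson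

end

/-!
At `g • p` the Poisson action gives `π_P(g p) = λ_{gp} π^r(g) + σ_{g*} π_P(p)`, where `λ_{gp}` is
the infinitesimal action. So `σ_g` preserves `π_P` exactly when `π^r(g)` vanishes on the
annihilators of the isotropy subalgebras, which yields the abelian condition by differentiation at
`1`. Conversely, the cocycle identity `π^r(g h) = π^r(g) + Ad_g π^r(h)` shows that the derivative of
`π^r(·)(ξ, η)` at `g` is, up to left translation, the dual bracket of `Ad_g^* ξ` and `Ad_g^* η`.
Since `Ad_g^*` carries the annihilator at `g p` to the one at `p`, these brackets all vanish, and
connectedness of `G` together with `π^r(1) = 0` gives `π^r(·)(ξ, η) = 0`.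
-/

section PushForm

variable {R V W : Type*} [CommRing R] [AddCommGroup V] [Module R V] [AddCommGroup W] [Module R W]

/-- The push-forward `L ⊗ L : V ⊗ V → W ⊗ W` of contravariant 2-tensors along a linear map `L`,
with tensors encoded as bilinear forms on the dual space. -/
def pushForm (L : V →ₗ[R] W) :
    LinearMap.BilinForm R (Module.Dual R V) →ₗ[R] LinearMap.BilinForm R (Module.Dual R W) where
  toFun B := B.compl₁₂ L.dualMap L.dualMap
  map_add' _ _ := rfl
  map_smul' _ _ := rfl

end PushForm

section PushFormField

variable {K V W : Type*} [Field K] [AddCommGroup V] [Module K V] [AddCommGroup W] [Module K W]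
  {L : V →ₗ[K] W} {B : LinearMap.BilinForm K (Module.Dual K V)}

theorem pushForm_eq_zero_iff :
    pushForm L B = 0 ↔
      ∀ ξ ∈ (LinearMap.ker L).dualAnnihilator, ∀ η ∈ (LinearMap.ker L).dualAnnihilator,
        B ξ η = 0 := by
  rw [← LinearMap.range_dualMap_eq_dualAnnihilator_ker]
  refine ⟨?_, fun h => LinearMap.ext₂ fun α β => h _ ⟨α, rfl⟩ _ ⟨β, rfl⟩⟩
  rintro h _ ⟨α, rfl⟩ _ ⟨β, rfl⟩
  exact LinearMap.congr_fun₂ h α β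

theorem pushForm_eq_zero_iff_of_injective (hL : Function.Injective L) :
    pushForm L B = 0 ↔ B = 0 := by
  rw [pushForm_eq_zero_iff, LinearMap.ker_eq_bot.2 hL, Submodule.dualAnnihilator_bot]
  exact ⟨fun h => LinearMap.ext₂ fun ξ η => h ξ trivial η trivial, fun h ξ _ η _ => by rw [h]; rfl⟩

end PushFormField

section Manifold

variable {𝕜 : Type*} [RCLike 𝕜]
  {E : Type*} [NormedAddCommGroup E] [NormedSpace 𝕜 E]
  {H : Type*} [TopologicalSpace H] {I : ModelWithCorners 𝕜 E H}
  {E' : Type*} [NormedAddCommGroup E'] [NormedSpace 𝕜 E']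
  {H' : Type*} [TopologicalSpace H'] {J : ModelWithCorners 𝕜 E' H'}
  {E'' : Type*} [NormedAddCommGroup E''] [NormedSpace 𝕜 E'']
  {H'' : Type*} [TopologicalSpace H''] {K : ModelWithCorners 𝕜 E'' H''}
  {M : Type*} [TopologicalSpace M] [ChartedSpace H M]
  {N : Type*} [TopologicalSpace N] [ChartedSpace H' N]
  {Q : Type*} [TopologicalSpace Q] [ChartedSpace H'' Q]

theorem isLocallyConstant_of_mfderiv_eq_zero [IsManifold I 1 M]
    {F : Type*} [NormedAddCommGroup F] [NormedSpace 𝕜 F] {f : M → F}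
    (hf : MDifferentiable I 𝓘(𝕜, F) f) (hf' : ∀ x, mfderiv I 𝓘(𝕜, F) f x = 0) :
    IsLocallyConstant f := by
  rw [IsLocallyConstant.iff_eventually_eq]
  intro x
  let _ : NormedSpace ℝ E := NormedSpace.restrictScalars ℝ 𝕜 E
  let φ := extChartAt I x
  obtain ⟨r, hr, hball⟩ := Metric.mem_nhdsWithin_iff.1 (extChartAt_target_mem_nhdsWithin (I := I) x)
  let s : Set E := Metric.ball (φ x) r ∩ Set.range I
  have hs : Convex ℝ s := (convex_ball _ _).inter I.convex_range
  have hderiv : ∀ z ∈ s, HasFDerivWithinAt (f ∘ φ.symm) (0 : E →L[𝕜] F) s z := fun z hz => by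
    have h := ((hf (φ.symm z)).hasMFDerivAt.comp_hasMFDerivWithinAt z
      (mdifferentiableWithinAt_extChartAt_symm (hball hz)).hasMFDerivWithinAt)
    rw [hf', ContinuousLinearMap.zero_comp] at h
    exact h.hasFDerivWithinAt.mono Set.inter_subset_right
  have hmem : φ x ∈ s := ⟨Metric.mem_ball_self hr, extChartAt_target_subset_range x
    (mem_extChartAt_target x)⟩
  have hnhds : φ ⁻¹' s ∈ nhds x := by
    refine extChartAt_preimage_mem_nhds_of_mem_nhdsWithin (by simp) ?_
    rw [show s = Set.range I ∩ Metric.ball (φ x) r from Set.inter_comm _ _]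
    exact inter_mem_nhdsWithin _ (Metric.ball_mem_nhds _ hr)
  filter_upwards [hnhds, extChartAt_source_mem_nhds (I := I) x] with y hy hy'
  have h : (f ∘ φ.symm) (φ y) = (f ∘ φ.symm) (φ x) := by
    have := hs.norm_image_sub_le_of_norm_hasFDerivWithin_le hderiv (C := 0) (by simp) hmem hy
    simpa [sub_eq_zero] using this
  simpa only [Function.comp_apply, φ, extChartAt_to_inv, (extChartAt I x).left_inv hy'] using h

theorem differential_comp {f : N → 𝕜} {φ : M → N} {x : M}
    (hf : MDifferentiableAt J 𝓘(𝕜, 𝕜) f (φ x)) (hφ : MDifferentiableAt I J φ x) :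
    differential I (f ∘ φ) x = differential J f (φ x) ∘ₗ (mfderiv I J φ x).toLinearMap := by
  rw [differential, mvfderiv_comp x hf hφ]
  rfl

theorem differential_continuousLinearMap_comp (a : E' →L[𝕜] 𝕜) {φ : M → E'} {x : M}
    (hφ : MDifferentiableAt I 𝓘(𝕜, E') φ x) (v : TangentSpace I x) :
    differential I (a ∘ φ) x v = a (mfderiv I 𝓘(𝕜, E') φ x v) := by
  rw [differential_comp a.mdifferentiableAt hφ, differential, mvfderiv, a.mfderiv_eq]
  rfl

theorem exists_differential_eq [FiniteDimensional 𝕜 E] [IsManifold I ∞ M] (x : M)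
    (α : Module.Dual 𝕜 (TangentSpace I x)) :
    ∃ f : M → 𝕜, ContMDiffAt I 𝓘(𝕜, 𝕜) ∞ f x ∧ differential I f x = α := by
  let a : E →L[𝕜] 𝕜 := LinearMap.toContinuousLinearMap (E := E) α
  refine ⟨a ∘ extChartAt I x, a.contMDiff.contMDiffAt.comp x contMDiffAt_extChartAt, ?_⟩
  ext v
  rw [differential_continuousLinearMap_comp a
    (mdifferentiableAt_extChartAt (mem_chart_source H x)), mfderiv_extChartAt_self]
  rfl

theorem mfderiv_eq_comp {ψ : N → Q} {φ : M → N} {χ : M → Q} {x : M} {y : N}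
    (hψ : MDifferentiableAt J K ψ y) (hφ : MDifferentiableAt I J φ x) (hy : φ x = y)
    (hχ : ∀ z, ψ (φ z) = χ z) :
    (mfderiv I K χ x : E →L[𝕜] E'')
      = (mfderiv J K ψ y : E' →L[𝕜] E'') ∘L (mfderiv I J φ x : E →L[𝕜] E') := by
  obtain rfl : ψ ∘ φ = χ := funext hχ
  subst hy
  exact mfderiv_comp x hψ hφ

theorem isPoissonMap_iff [FiniteDimensional 𝕜 E'] [IsManifold J ∞ N]
    {πM : CotangentForm I M} {πN : CotangentForm J N} {φ : M → N} (hφ : ContMDiff I J ∞ φ) :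
    IsPoissonMap πM πN φ ↔
      ∀ x, pushForm (mfderiv I J φ x).toLinearMap (πM x) = πN (φ x) := by
  have hd (f : N → 𝕜) (x : M) (hf : ContMDiffAt J 𝓘(𝕜, 𝕜) ∞ f (φ x)) :=
    differential_comp (hf.mdifferentiableAt (by simp)) (hφ.mdifferentiable (by simp) x)
  constructor
  · refine fun h x => LinearMap.ext₂ fun α β => ?_
    obtain ⟨f, hf, rfl⟩ := exists_differential_eq (φ x) α
    obtain ⟨g, hg, rfl⟩ := exists_differential_eq (φ x) β
    have hfg := h.map_bracket x f g hf hg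
    rwa [poissonBracket, hd f x hf, hd g x hg] at hfg
  · refine fun h => ⟨hφ, fun x f g hf hg => ?_⟩
    rw [poissonBracket, hd f x hf, hd g x hg]
    exact LinearMap.congr_fun₂ (h x) _ _

theorem pushForm_prodForm (πM : CotangentForm I M) (πN : CotangentForm J N) {φ : M × N → Q}
    {x : M} {y : N} (hφ : MDifferentiableAt (I.prod J) K φ (x, y)) :
    pushForm (mfderiv (I.prod J) K φ (x, y)).toLinearMap (prodForm πM πN (x, y))
      = pushForm (mfderiv I K (fun x' => φ (x', y)) x).toLinearMap (πM x)
        + pushForm (mfderiv J K (fun y' => φ (x, y')) y).toLinearMap (πN y) := by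
  have h₁ : mfderiv I K (fun x' => φ (x', y)) x = _ :=
    mfderiv_comp (f := fun x' : M => (x', y)) x hφ
      (mdifferentiableAt_id.prodMk mdifferentiableAt_const)
  have h₂ : mfderiv J K (fun y' => φ (x, y')) y = _ :=
    mfderiv_comp (f := fun y' : N => (x, y')) y hφ
      (mdifferentiableAt_const.prodMk mdifferentiableAt_id)
  rw [h₁, h₂]
  rfl

theorem IsPoissonMap.apply_prod [FiniteDimensional 𝕜 E''] [IsManifold K ∞ Q]
    {πM : CotangentForm I M} {πN : CotangentForm J N} {πQ : CotangentForm K Q} {φ : M × N → Q}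
    (hφ : IsPoissonMap (prodForm πM πN) πQ φ) (x : M) (y : N) :
    πQ (φ (x, y)) = pushForm (mfderiv I K (fun x' => φ (x', y)) x).toLinearMap (πM x)
      + pushForm (mfderiv J K (fun y' => φ (x, y')) y).toLinearMap (πN y) := by
  rw [← (isPoissonMap_iff hφ.smooth).1 hφ (x, y)]
  exact pushForm_prodForm πM πN (hφ.smooth.mdifferentiable (by simp) (x, y))

end Manifold

section SmoothForm

variable {𝕜 : Type*} [RCLike 𝕜]
  {E : Type*} [NormedAddCommGroup E] [NormedSpace 𝕜 E]
  {H : Type*} [TopologicalSpace H] {I : ModelWithCorners 𝕜 E H}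
  {M : Type*} [TopologicalSpace M] [ChartedSpace H M]

/-- Smoothness of a field of 2-tensors, tested on differentials of smooth functions as in
`IsPoisson.smooth`. -/
def IsSmoothForm (π : CotangentForm I M) : Prop :=
  ∀ (p : M) (f g : M → 𝕜), ContMDiffAt I 𝓘(𝕜, 𝕜) ∞ f p → ContMDiffAt I 𝓘(𝕜, 𝕜) ∞ g p →
    ContMDiffAt I 𝓘(𝕜, 𝕜) ∞ (poissonBracket π f g) p

variable [FiniteDimensional 𝕜 E]

theorem eq_sum_smul_differential [IsManifold I 1 M] {ι : Type*} [Fintype ι]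
    (b : Module.Basis ι 𝕜 E) {x₀ x : M} (hx : x ∈ (chartAt H x₀).source)
    (α : Module.Dual 𝕜 (TangentSpace I x)) :
    α = ∑ i, α ((trivializationAt E (TangentSpace I) x₀).symmL 𝕜 x (b i)) •
      differential I ((b.coord i).toContinuousLinearMap ∘ extChartAt I x₀) x := by
  let e := trivializationAt E (TangentSpace I : M → Type _) x₀
  have hd (i : ι) (v : TangentSpace I x) :
      differential I ((b.coord i).toContinuousLinearMap ∘ extChartAt I x₀) x v
        = b.repr (e.continuousLinearMapAt 𝕜 x v) i := by
    rw [differential_continuousLinearMap_comp _ (mdifferentiableAt_extChartAt hx),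
      TangentBundle.continuousLinearMapAt_trivializationAt hx]
    rfl
  ext v
  calc α v = α (e.symmL 𝕜 x (∑ i, b.repr (e.continuousLinearMapAt 𝕜 x v) i • b i)) := by
        rw [b.sum_repr, e.symmL_continuousLinearMapAt hx]
    _ = _ := by
        simp only [map_sum, map_smul, LinearMap.sum_apply, LinearMap.smul_apply, hd, smul_eq_mul,
          mul_comm, e]

theorem IsSmoothForm.contMDiffAt_apply [IsManifold I ∞ M] {π : CotangentForm I M}
    (hπ : IsSmoothForm π) {α β : ∀ x : M, Module.Dual 𝕜 (TangentSpace I x)} {x₀ : M}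
    (hα : ∀ v, ContMDiffAt I 𝓘(𝕜, 𝕜) ∞
      (fun x => α x ((trivializationAt E (TangentSpace I) x₀).symmL 𝕜 x v)) x₀)
    (hβ : ∀ v, ContMDiffAt I 𝓘(𝕜, 𝕜) ∞
      (fun x => β x ((trivializationAt E (TangentSpace I) x₀).symmL 𝕜 x v)) x₀) :
    ContMDiffAt I 𝓘(𝕜, 𝕜) ∞ (fun x => π x (α x) (β x)) x₀ := by
  let b := Module.finBasis 𝕜 E
  let e := trivializationAt E (TangentSpace I : M → Type _) x₀
  let f (i) : M → 𝕜 := (b.coord i).toContinuousLinearMap ∘ extChartAt I x₀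
  have hf (i) : ContMDiffAt I 𝓘(𝕜, 𝕜) ∞ (f i) x₀ :=
    (b.coord i).toContinuousLinearMap.contMDiff.contMDiffAt.comp x₀ contMDiffAt_extChartAt
  have hsum : ContMDiffAt I 𝓘(𝕜, 𝕜) ∞ (fun x => ∑ i, ∑ j, α x (e.symmL 𝕜 x (b i)) *
      (β x (e.symmL 𝕜 x (b j)) * poissonBracket π (f i) (f j) x)) x₀ :=
    contMDiffAt_finsetSum fun i _ => contMDiffAt_finsetSum fun j _ =>
      (hα (b i)).mul ((hβ (b j)).mul (hπ x₀ _ _ (hf i) (hf j)))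
  refine hsum.congr_of_eventuallyEq ?_
  filter_upwards [(chartAt H x₀).open_source.mem_nhds (mem_chart_source H x₀)] with x hx
  refine (congrArg₂ (π x · ·) (eq_sum_smul_differential b hx (α x))
    (eq_sum_smul_differential b hx (β x))).trans ?_
  simp only [LinearMap.BilinForm.sum_left, LinearMap.BilinForm.sum_right,
    LinearMap.BilinForm.smul_left, LinearMap.BilinForm.smul_right, Finset.mul_sum]
  rw [Finset.sum_comm]
  exact Finset.sum_congr rfl fun i _ => Finset.sum_congr rfl fun j _ => mul_left_comm _ _ _

end SmoothForm
section PoissonLie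

variable {𝕜 : Type*} [RCLike 𝕜]
  {E : Type*} [NormedAddCommGroup E] [NormedSpace 𝕜 E]
  {H : Type*} [TopologicalSpace H] {I : ModelWithCorners 𝕜 E H}
  {G : Type*} [TopologicalSpace G] [ChartedSpace H G] [Group G]

variable (I) in
/-- The adjoint action `Ad_g : 𝔤 → 𝔤`, the differential at `1` of conjugation by `g`. -/
noncomputable def adjointMap (g : G) : GroupLieAlgebra I G →L[𝕜] GroupLieAlgebra I G :=
  (mfderiv I I (fun x : G => g * x * g⁻¹) 1 :
    TangentSpace I (1 : G) →L[𝕜] TangentSpace I (g * 1 * g⁻¹))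

/-- Multiplicativity of a field of 2-tensors: multiplication `G × G → G` maps `π ⊕ π` to `π`. -/
def IsMultiplicative (π : CotangentForm I G) : Prop :=
  IsPoissonMap (prodForm π π) π (fun z : G × G => z.1 * z.2)

theorem dualBracket_eq_zero_of_rightForm_eq_zero {π : CotangentForm I G}
    {ξ η : Module.Dual 𝕜 (GroupLieAlgebra I G)}
    (h : ∀ g : G, rightForm π g ξ η = 0) : dualBracket π ξ η = 0 := by
  rw [dualBracket, funext h, differential, mvfderiv_const]
  rfl

section RightTransport

variable [ContMDiffMul I 1 G]

theorem rightTransport_comp_mul_right (g h : G) :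
    rightTransport I (g * h) ∘L mfderiv I I (· * h) g = rightTransport I g :=
  (mfderiv_eq_comp (ψ := (· * (g * h)⁻¹)) (φ := (· * h)) (χ := (· * g⁻¹))
    mdifferentiableAt_mul_right mdifferentiableAt_mul_right rfl
    fun x => by simp [mul_assoc]).symm

theorem rightTransport_comp_mul_left (g h : G) :
    rightTransport I (g * h) ∘L mfderiv I I (g * ·) h = adjointMap I g ∘L rightTransport I h :=
  (mfderiv_eq_comp (ψ := (· * (g * h)⁻¹)) (φ := (g * ·)) (χ := (g * · * (g * h)⁻¹))
      mdifferentiableAt_mul_right mdifferentiableAt_mul_left rfl fun _ => rfl).symm.trans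
    (mfderiv_eq_comp (ψ := (g * · * g⁻¹)) (φ := (· * h⁻¹))
      (mdifferentiableAt_mul_right.comp _ mdifferentiableAt_mul_left)
      mdifferentiableAt_mul_right (mul_inv_cancel h) fun x => by simp [mul_assoc])

theorem rightTransport_injective (g : G) : Function.Injective (rightTransport I g) := by
  have h := mfderiv_eq_comp (I := I) (J := I) (K := I) (ψ := (· * g)) (φ := (· * g⁻¹)) (χ := id)
    mdifferentiableAt_mul_right mdifferentiableAt_mul_right (mul_inv_cancel g)
    fun x => inv_mul_cancel_right x g
  rw [mfderiv_id] at h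
  exact Function.LeftInverse.injective (g := mfderiv I I (· * g) 1) fun v =>
    (DFunLike.congr_fun h v).symm

theorem rightForm_eq_zero_iff {π : CotangentForm I G} {g : G} : rightForm π g = 0 ↔ π g = 0 :=
  pushForm_eq_zero_iff_of_injective (rightTransport_injective g)

end RightTransport

section Multiplicative

variable [LieGroup I ∞ G]

theorem contMDiffAt_rightTransport (v : E) (g₀ : G) :
    ContMDiffAt (M' := E) I 𝓘(𝕜, E) ∞ (fun g : G => rightTransport I g
      ((trivializationAt E (TangentSpace I) g₀).symmL 𝕜 g v)) g₀ := by
  have hf : ContMDiff (I.prod I) I ∞ (Function.uncurry fun g x : G => x * g⁻¹) :=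
    contMDiff_snd.mul contMDiff_fst.inv
  have h := ContMDiffAt.mfderiv_apply (m := ∞) (n := ∞) (I := I) (I' := I) (J := I) (J' := I)
    (x₀ := g₀) (fun g x : G => x * g⁻¹) id id (fun _ => v) hf.contMDiffAt contMDiffAt_id
    contMDiffAt_id contMDiffAt_const le_rfl
  -- The base points `g * g⁻¹` all equal `1`, but not definitionally, so the trivialization in which
  -- `ContMDiffAt.mfderiv_apply` reads the target has to be identified with the identity.
  have hid {y z : G} (hyz : y = z) :
      ((trivializationAt E (TangentSpace I) y).continuousLinearMapAt 𝕜 z : E →L[𝕜] E)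
        = .id 𝕜 E := by
    subst hyz
    rw [TangentBundle.continuousLinearMapAt_trivializationAt (mem_chart_source H y),
      mfderiv_extChartAt_self]
    rfl
  refine h.congr_of_eventuallyEq (.of_forall fun g => ?_)
  exact (DFunLike.congr_fun (hid ((mul_inv_cancel g₀).trans (mul_inv_cancel g).symm)) _).symm

variable [FiniteDimensional 𝕜 E] {π : CotangentForm I G}

theorem IsMultiplicative.rightForm_mul (hπ : IsMultiplicative π) (g h : G) :
    rightForm π (g * h)
      = rightForm π g + pushForm (adjointMap I g).toLinearMap (rightForm π h) := by
  have h₁ := congrArg (fun L => pushForm L.toLinearMap (π g))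
    (rightTransport_comp_mul_right (I := I) g h)
  have h₂ := congrArg (fun L => pushForm L.toLinearMap (π h))
    (rightTransport_comp_mul_left (I := I) g h)
  change pushForm (rightTransport I (g * h)).toLinearMap (π (g * h)) = _
  rw [IsPoissonMap.apply_prod hπ g h, map_add]
  exact congrArg₂ (· + ·) h₁ h₂

theorem IsMultiplicative.rightForm_one (hπ : IsMultiplicative π) : rightForm π (1 : G) = 0 := by
  have hAd : adjointMap I (1 : G) = .id 𝕜 _ := by
    rw [adjointMap, show (fun x : G => 1 * x * (1 : G)⁻¹) = id by ext; simp]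
    exact mfderiv_id
  have h := hπ.rightForm_mul 1 1
  rw [mul_one, hAd] at h
  exact LinearMap.ext₂ fun ξ η => left_eq_add.1 (LinearMap.congr_fun₂ h ξ η)

theorem IsSmoothForm.contMDiff_rightForm (hπ : IsSmoothForm π)
    (ξ η : Module.Dual 𝕜 (GroupLieAlgebra I G)) :
    ContMDiff I 𝓘(𝕜, 𝕜) ∞ (fun g : G => rightForm π g ξ η) := fun g₀ => by
  have hcoeff (ζ : Module.Dual 𝕜 E) (v : E) :=
    ζ.toContinuousLinearMap.contMDiff.contMDiffAt (n := ∞).comp g₀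
      (contMDiffAt_rightTransport (I := I) v g₀)
  exact hπ.contMDiffAt_apply (α := fun g => (rightTransport I g).toLinearMap.dualMap ξ)
    (β := fun g => (rightTransport I g).toLinearMap.dualMap η) (hcoeff ξ) (hcoeff η)

theorem IsMultiplicative.differential_rightForm (hπ : IsMultiplicative π) (hs : IsSmoothForm π)
    (g : G) (ξ η : Module.Dual 𝕜 (GroupLieAlgebra I G)) (v : TangentSpace I g) :
    differential I (fun x => rightForm π x ξ η) g v
      = dualBracket π ((adjointMap I g).toLinearMap.dualMap ξ)
          ((adjointMap I g).toLinearMap.dualMap η) (mfderiv I I (g⁻¹ * ·) g v) := by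
  let F (x : G) : 𝕜 := rightForm π x ((adjointMap I g).toLinearMap.dualMap ξ)
    ((adjointMap I g).toLinearMap.dualMap η)
  let c : 𝕜 := rightForm π g ξ η
  have hF : MDifferentiableAt I 𝓘(𝕜, 𝕜) F 1 :=
    (hs.contMDiff_rightForm _ _).mdifferentiable (by simp) 1
  have hcocycle (x : G) : c + F (g⁻¹ * x) = rightForm π x ξ η := by
    have h := hπ.rightForm_mul g (g⁻¹ * x)
    rw [mul_inv_cancel_left] at h
    rw [h]
    rfl
  have hadd : mvfderiv I (fun x => c + F x) 1 = mvfderiv I F 1 := by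
    rw [mvfderiv_fun_add mdifferentiableAt_const hF, mvfderiv_const, zero_add]
  have hchain := mfderiv_eq_comp (I := I) (φ := (g⁻¹ * ·)) (mdifferentiableAt_const.add hF)
    mdifferentiableAt_mul_left (inv_mul_cancel g) hcocycle
  exact (DFunLike.congr_fun hchain v).trans (DFunLike.congr_fun hadd _)

theorem IsMultiplicative.rightForm_eq_zero_of_dualBracket_eq_zero [PreconnectedSpace G]
    (hπ : IsMultiplicative π) (hs : IsSmoothForm π)
    {ξ η : Module.Dual 𝕜 (GroupLieAlgebra I G)}
    (h : ∀ g : G, dualBracket π ((adjointMap I g).toLinearMap.dualMap ξ)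
      ((adjointMap I g).toLinearMap.dualMap η) = 0) (g : G) :
    rightForm π g ξ η = 0 := by
  have hd (x : G) : mfderiv I 𝓘(𝕜, 𝕜) (fun y => rightForm π y ξ η) x = 0 :=
    ContinuousLinearMap.ext fun v => (hπ.differential_rightForm hs x ξ η v).trans (by rw [h x]; rfl)
  have hconst := isLocallyConstant_of_mfderiv_eq_zero
    ((hs.contMDiff_rightForm ξ η).mdifferentiable (by simp)) hd
  rw [hconst.apply_eq_of_preconnectedSpace g 1, hπ.rightForm_one]
  rfl

end Multiplicative

end PoissonLie

section Action

variable {𝕜 : Type*} [RCLike 𝕜]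
  {E : Type*} [NormedAddCommGroup E] [NormedSpace 𝕜 E]
  {H : Type*} [TopologicalSpace H] {I : ModelWithCorners 𝕜 E H}
  {E' : Type*} [NormedAddCommGroup E'] [NormedSpace 𝕜 E']
  {H' : Type*} [TopologicalSpace H'] {J : ModelWithCorners 𝕜 E' H'}
  {G : Type*} [TopologicalSpace G] [ChartedSpace H G] [Group G]
  {P : Type*} [TopologicalSpace P] [ChartedSpace H' P] [MulAction G P]

section Infinitesimal

theorem mdifferentiable_const_smul (I : ModelWithCorners 𝕜 E H) [ContMDiffSMul I J 1 G P] (g : G) :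
    MDifferentiable J J (fun p : P => g • p) :=
  ((contMDiff_const (I' := I)).smul contMDiff_id :
    ContMDiff J J 1 fun p : P => g • p).mdifferentiable one_ne_zero

variable [ContMDiffSMul I J 1 G P]

theorem mdifferentiable_smul_const (p : P) : MDifferentiable I J (fun g : G => g • p) :=
  (contMDiff_id.smul contMDiff_const : ContMDiff I J 1 fun g : G => g • p).mdifferentiable
    one_ne_zero

variable [ContMDiffMul I 1 G]

theorem infinitesimalAction_comp_rightTransport (g : G) (p : P) :
    (infinitesimalAction I J G (g • p) : E →L[𝕜] E') ∘L (rightTransport I g : E →L[𝕜] E)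
      = (mfderiv I J (fun x : G => x • p) g : E →L[𝕜] E') :=
  (mfderiv_eq_comp (ψ := fun x : G => x • g • p) (φ := (· * g⁻¹)) (mdifferentiable_smul_const _ _)
    mdifferentiableAt_mul_right (mul_inv_cancel g) fun x => by simp [mul_smul]).symm

theorem pushForm_mfderiv_smul_eq_zero_iff {π : CotangentForm I G} {g : G} {p : P} :
    pushForm (mfderiv I J (fun x : G => x • p) g).toLinearMap (π g) = 0 ↔
      ∀ ξ ∈ (isotropyAlgebra I J G (g • p)).dualAnnihilator,
        ∀ η ∈ (isotropyAlgebra I J G (g • p)).dualAnnihilator, rightForm π g ξ η = 0 := by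
  have h := congrArg (fun L => pushForm L.toLinearMap (π g))
    (infinitesimalAction_comp_rightTransport (I := I) (J := J) g p)
  exact (iff_of_eq (congrArg (· = 0) h.symm)).trans
    (pushForm_eq_zero_iff (L := (infinitesimalAction I J G (g • p)).toLinearMap)
      (B := rightForm π g))

theorem infinitesimalAction_comp_adjointMap (g : G) (p : P) :
    (infinitesimalAction I J G (g • p) : E →L[𝕜] E') ∘L (adjointMap I g : E →L[𝕜] E)
      = (mfderiv J J (fun x : P => g • x) p : E' →L[𝕜] E') ∘L
        (infinitesimalAction I J G p : E →L[𝕜] E') :=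
  (mfderiv_eq_comp (ψ := fun x : G => x • g • p) (φ := (g * · * g⁻¹))
      (χ := fun x => g • x • p) (x := 1) (mdifferentiable_smul_const _ _)
      (mdifferentiableAt_mul_right.comp _ mdifferentiableAt_mul_left) (by simp)
      fun x => by simp [mul_smul]).symm.trans
    (mfderiv_eq_comp (φ := (· • p)) (mdifferentiable_const_smul I g p)
      (mdifferentiable_smul_const p 1) (one_smul G p) fun _ => rfl)

theorem adjointMap_mem_isotropyAlgebra {g : G} {p : P} {X : GroupLieAlgebra I G}
    (hX : X ∈ isotropyAlgebra I J G p) : adjointMap I g X ∈ isotropyAlgebra I J G (g • p) := by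
  have hX' : infinitesimalAction I J G p X = 0 := hX
  have h := DFunLike.congr_fun (infinitesimalAction_comp_adjointMap (I := I) (J := J) g p) X
  exact h.trans ((congrArg _ hX').trans (map_zero (mfderiv J J (fun x : P => g • x) p)))

theorem dualMap_adjointMap_mem_dualAnnihilator {g : G} {p : P}
    {ξ : Module.Dual 𝕜 (GroupLieAlgebra I G)}
    (hξ : ξ ∈ (isotropyAlgebra I J G (g • p)).dualAnnihilator) :
    (adjointMap I g).toLinearMap.dualMap ξ ∈ (isotropyAlgebra I J G p).dualAnnihilator :=
  (Submodule.mem_dualAnnihilator _).2 fun _ hX =>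
    (Submodule.mem_dualAnnihilator _).1 hξ _ (adjointMap_mem_isotropyAlgebra hX)

end Infinitesimal

namespace IsPoissonAction

variable {πG : CotangentForm I G} {πP : CotangentForm J P}

theorem contMDiffSMul (hσ : IsPoissonAction πG πP) : ContMDiffSMul I J ∞ G P :=
  ⟨IsPoissonMap.smooth hσ⟩

variable [LieGroup I ∞ G] [FiniteDimensional 𝕜 E'] [IsManifold J ∞ P]

set_option maxSynthPendingDepth 3 in
theorem actionPreserves_iff (hσ : IsPoissonAction πG πP) :
    ActionPreserves G πP ↔ ∀ (g : G) (p : P), ∀ ξ ∈ (isotropyAlgebra I J G p).dualAnnihilator,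
      ∀ η ∈ (isotropyAlgebra I J G p).dualAnnihilator, rightForm πG g ξ η = 0 := by
  have := hσ.contMDiffSMul
  have hsmooth (g : G) : ContMDiff J J ∞ (fun x : P => g • x) :=
    (contMDiff_const (I' := I)).smul contMDiff_id
  refine forall_congr' fun g => (isPoissonMap_iff (hsmooth g)).trans ?_
  refine (forall_congr' fun p => ?_).trans (MulAction.surjective g).forall.symm
  have hsum : πP (g • p) = pushForm (mfderiv I J (fun x : G => x • p) g).toLinearMap (πG g)
      + pushForm (mfderiv J J (fun x : P => g • x) p).toLinearMap (πP p) :=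
    IsPoissonMap.apply_prod hσ g p
  rw [hsum, right_eq_add, pushForm_mfderiv_smul_eq_zero_iff]

end IsPoissonAction

end Action

theorem proposition4p1_general {𝕜 : Type*} [RCLike 𝕜]
    {E : Type*} [NormedAddCommGroup E] [NormedSpace 𝕜 E] [FiniteDimensional 𝕜 E]
    {H : Type*} [TopologicalSpace H] {I : ModelWithCorners 𝕜 E H}
    {E' : Type*} [NormedAddCommGroup E'] [NormedSpace 𝕜 E'] [FiniteDimensional 𝕜 E']
    {H' : Type*} [TopologicalSpace H'] {J : ModelWithCorners 𝕜 E' H'}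
    {G : Type*} [TopologicalSpace G] [ChartedSpace H G] [Group G] [LieGroup I ∞ G]
    [PreconnectedSpace G]
    {P : Type*} [TopologicalSpace P] [ChartedSpace H' P] [IsManifold J ∞ P] [MulAction G P]
    {πG : CotangentForm I G} (hs : IsSmoothForm πG) (hm : IsMultiplicative πG)
    {πP : CotangentForm J P} (hσ : IsPoissonAction πG πP) :
    (ActionPreserves G πP ↔
      ∀ p : P, IsAbelianSubspace πG (isotropyAlgebra I J G p).dualAnnihilator) ∧
    ∀ p : P, isotropyAlgebra I J G p = ⊥ → (ActionPreserves G πP ↔ πG = 0) := by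
  have := hσ.contMDiffSMul
  refine ⟨⟨fun h p ξ hξ η hη => ?_, fun h => ?_⟩, fun p hp => ⟨fun h => ?_, ?_⟩⟩
  · exact dualBracket_eq_zero_of_rightForm_eq_zero fun g =>
      hσ.actionPreserves_iff.1 h g p ξ hξ η hη
  · refine hσ.actionPreserves_iff.2 fun g p ξ hξ η hη =>
      hm.rightForm_eq_zero_of_dualBracket_eq_zero hs (fun x => ?_) g
    obtain ⟨q, rfl⟩ := MulAction.surjective x p
    exact h q _ (dualMap_adjointMap_mem_dualAnnihilator hξ) _
      (dualMap_adjointMap_mem_dualAnnihilator hη)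
  · have hann (ξ) : ξ ∈ (isotropyAlgebra I J G p).dualAnnihilator := by
      rw [hp, Submodule.dualAnnihilator_bot]
      trivial
    refine funext fun g => rightForm_eq_zero_iff.1 (LinearMap.ext₂ fun ξ η => ?_)
    exact hσ.actionPreserves_iff.1 h g p ξ (hann ξ) η (hann η)
  · rintro rfl
    exact hσ.actionPreserves_iff.2 fun g p ξ _ η _ => rfl

theorem proposition4p1 {𝕜 : Type*} [RCLike 𝕜]
    {E : Type*} [NormedAddCommGroup E] [NormedSpace 𝕜 E] [FiniteDimensional 𝕜 E]
    {H : Type*} [TopologicalSpace H] (I : ModelWithCorners 𝕜 E H) [I.Boundaryless]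
    {E' : Type*} [NormedAddCommGroup E'] [NormedSpace 𝕜 E'] [FiniteDimensional 𝕜 E']
    {H' : Type*} [TopologicalSpace H'] (J : ModelWithCorners 𝕜 E' H') [J.Boundaryless]
    {G : Type*} [TopologicalSpace G] [ChartedSpace H G] [Group G] [LieGroup I ∞ G]
    [ConnectedSpace G]
    {P : Type*} [TopologicalSpace P] [ChartedSpace H' P] [IsManifold J ∞ P]
    [MulAction G P] [ContMDiffSMul I J ∞ G P]
    (πG : CotangentForm I G) (hG : IsPoissonLie πG)
    (πP : CotangentForm J P) (hP : IsPoisson πP)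
    (hσ : IsPoissonAction πG πP) :
    (ActionPreserves G πP ↔
      ∀ p : P, IsAbelianSubspace πG (isotropyAlgebra I J G p).dualAnnihilator) ∧
    (Nonempty P → IsLocallyFreeAction I J G P → (ActionPreserves G πP ↔ πG = 0)) := by
  have h := proposition4p1_general hG.isPoisson.smooth hG.mul hσ
  exact ⟨h.1, fun ⟨p⟩ hfree => h.2 p (hfree p)⟩
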